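/- All objects are smooth ($C^\infty$). Let $L$ be a smooth manifold. A \emph{Levi flat structure} on $L$ is a pair $(\xi,J)$, where $\xi\subset T(L)$ is an integrable distribution of codimension $1$ (the space $\mathcal H(\xi)$ of vector fields tangent to $\xi$ is closed under the Lie bracket) and $J$ is a complex structure on the bundle $\xi$ ($J\in\mathrm{End}(\xi)$, $J^2=-I$) which is integrable along the leaves, i.e. $N_J(V,W)=[JV,JW]-[V,W]-J[JV,W]-J[V,JW]$ vanishes for all $V,W\in\mathcal H(\xi)$. Let $(\xi,J)$ be a Levi flat structure on $L$, and let $\gamma$ be a $1$-form and $X$ a vector field on $L$ with $\ker\gamma=\xi$ and $\gamma(X)=1$. For $1$-forms set $\{\alpha,\beta\}=\mathcal L_X\alpha\wedge\beta-\alpha\wedge\mathcal L_X\beta$ and $\delta\alpha=d\alpha+\{\gamma,\alpha\}$. Let $\alpha\in\mathcal Z^1(L)$, i.e. $\alpha$ is a $1$-form with $\alpha(X)=0$, and put $\xi_\alpha=\ker(\gamma+\alpha)$, $\omega_\alpha(V)=V-\alpha(V)X$ (an isomorphism $\xi\to\xi_\alpha$ with inverse $V\mapsto V+\alpha(V)X$)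 and $[V,W]_\alpha=\omega_\alpha^{-1}[\omega_\alpha V,\omega_\alpha W]$. For $V,W\in\mathcal H(\xi)$ set $$N^\alpha_J(V,W)=[JV,JW]_\alpha-[V,W]_\alpha-J[JV,W]_\alpha-J[V,JW]_\alpha,$$ $$(\overline\partial{}^\alpha_J W)(V)=\tfrac12\big([V,W]_\alpha+J[JV,W]_\alpha\big)+\tfrac14N^\alpha_J(V,W),$$ and, for $S\in\Lambda^{0,1}_J(\xi)\otimes\xi$ (i.e. $S\in\mathrm{End}(\xi)$ with $SJ=-JS$), $$\overline\partial{}^\alpha_JS(V,W)=\overline\partial{}^\alpha_J(SW)(V)-\overline\partial{}^\alpha_J(SV)(W)-\tfrac12S\big([V,W]_\alpha-[JV,JW]_\alpha\big),$$ $$[S,S]_\alpha(V,W)=[SV,SW]_\alpha-[JSV,JSW]_\alpha-S\big([SV,W]_\alpha+[V,SW]_\alpha+J[V,JSW]_\alpha+J[JSV,W]_\alpha\big)-\tfrac12\big(SN^\alpha_J(SV,W)+SN^\alpha_J(V,SW)-N^\alpha_J(SV,SW)\big),$$ $$[[S,S]]_\alpha(V,W)=[S,S]_\alpha(V,W)-\tfrac12S\big(N^\alpha_J(V,W)-N^\alpha_J(SV,SW)\big).$$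 Finally let $T(V)=[V,X]-\gamma([V,X])X$, $H(V)=\tfrac12(T(V)+JT(JV))$, $\alpha^{0,1}_J(V)=\tfrac12(\alpha(V)+i\,\alpha(JV))$ for $V\in\mathcal H(\xi)$, and $(\alpha^{0,1}_J\wedge H)(V,W)=\alpha^{0,1}_J(V)H(W)-\alpha^{0,1}_J(W)H(V)$, where $i$ acts on $\xi$ as $J$. Let $J_\alpha$ be a complex structure on $\xi_\alpha$, and let $S_\alpha\in\Lambda^{0,1}_J(\xi)\otimes\xi$ be the (necessarily unique) form such that $I+S_\alpha$ is invertible and $\omega_\alpha^{-1}J_\alpha\omega_\alpha=(I+S_\alpha)J(I+S_\alpha)^{-1}$ on $\xi$ (it is assumed that such a form exists). Then the following are equivalent: 1) $(\xi_\alpha,J_\alpha)$ is a Levi flat structure. 2) $\delta\alpha+\tfrac12\{\alpha,\alpha\}=0$ (which implies $[V,W]_\alpha\in\mathcal H(\xi)$ for $V,W\in\mathcal H(\xi)$, so that the expressions above make sense), and $$\overline\partial{}^\alpha_JS_\alpha+\tfrac12[[S_\alpha,S_\alpha]]_\alpha=\tfrac14N^\alpha_J=-\alpha^{0,1}_J\wedge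 H .$$ -/

import Mathlib

open scoped Manifold ContDiff Topology

noncomputable section

namespace LeviFlat

/-! ## Brackets, Nijenhuis tensor and the operators attached to a complex structure

Here `g` is a real vector space, `br` a bracket on `g`, and `J`, `S` are operators on `g`. -/

section Algebra

variable {g : Type*} [AddCommGroup g] [Module ℝ g]

/-- The Nijenhuis tensor `N(V,W) = [JV,JW] - [V,W] - J[JV,W] - J[V,JW]`. -/
def nijenhuis (br : g → g → g) (J : g → g) (V W : g) : g :=
  br (J V) (J W) - br V W - J (br (J V) W) - J (br V (J W))

/-- `(∂̄ W)(V) = ½ ([V,W] + J[JV,W]) + ¼ N(V,W)`. -/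
def dbar (br : g → g → g) (J : g → g) (W V : g) : g :=
  (1 / 2 : ℝ) • (br V W + J (br (J V) W)) + (1 / 4 : ℝ) • nijenhuis br J V W

/-- `(∂̄ S)(V,W) = ∂̄(SW)(V) - ∂̄(SV)(W) - ½ S([V,W] - [JV,JW])`. -/
def dbarOne (br : g → g → g) (J S : g → g) (V W : g) : g :=
  dbar br J (S W) V - dbar br J (S V) W - (1 / 2 : ℝ) • S (br V W - br (J V) (J W))

/-- The bracket `[S,S]`. -/
def selfBracket (br : g → g → g) (J S : g → g) (V W : g) : g :=
  br (S V) (S W) - br (J (S V)) (J (S W))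
    - S (br (S V) W + br V (S W) + J (br V (J (S W))) + J (br (J (S V)) W))
    - (1 / 2 : ℝ) • (S (nijenhuis br J (S V) W) + S (nijenhuis br J V (S W))
        - nijenhuis br J (S V) (S W))

/-- The modified bracket `[[S,S]] = [S,S] - ½ S (N - N(S,S))`,
where `N(S,S)(V,W) = N(SV,SW)`. -/
def doubleBracket (br : g → g → g) (J S : g → g) (V W : g) : g :=
  selfBracket br J S V W
    - (1 / 2 : ℝ) • S (nijenhuis br J V W - nijenhuis br J (S V) (S W))

end Algebra

/-! ## Vector fields, one-forms and distributions on a smooth manifold -/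

variable {E : Type*} [NormedAddCommGroup E] [NormedSpace ℝ E]
variable {M : Type*} [TopologicalSpace M] [ChartedSpace E M]
  [IsManifold 𝓘(ℝ, E) ∞ M]

/-- A vector field `V` on `M` is smooth. -/
def IsSmoothField (V : ∀ x : M, TangentSpace 𝓘(ℝ, E) x) : Prop :=
  ContMDiff 𝓘(ℝ, E) 𝓘(ℝ, E).tangent ∞
    (fun x => (⟨x, V x⟩ : TangentBundle 𝓘(ℝ, E) M))

/-- A field of covectors on `M` is smooth, i.e. it is a differential one-form. -/
def IsSmoothForm
    (α : ∀ x : M, TangentSpace 𝓘(ℝ, E) x →L[ℝ] ℝ) : Prop :=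
  ContMDiff 𝓘(ℝ, E) (𝓘(ℝ, E).prod 𝓘(ℝ, E →L[ℝ] ℝ)) ∞
    (fun x => Bundle.TotalSpace.mk' (E →L[ℝ] ℝ)
      (E := fun x : M => TangentSpace 𝓘(ℝ, E) x →L[ℝ] Bundle.Trivial M ℝ x) x (α x))

/-- The function `V(f)`, the derivative of the function `f` along the vector field `V`. -/
def dirDeriv (V : ∀ x : M, TangentSpace 𝓘(ℝ, E) x) (f : M → ℝ) (x : M) : ℝ :=
  mfderiv 𝓘(ℝ, E) 𝓘(ℝ, ℝ) f x (V x)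

/-- The Lie bracket of vector fields. -/
abbrev lie (V W : ∀ x : M, TangentSpace 𝓘(ℝ, E) x) : ∀ x : M, TangentSpace 𝓘(ℝ, E) x :=
  VectorField.mlieBracket 𝓘(ℝ, E) V W

/-- The kernel of a field of covectors. -/
def kerForm (β : ∀ x : M, TangentSpace 𝓘(ℝ, E) x →L[ℝ] ℝ) (x : M) :
    Submodule ℝ (TangentSpace 𝓘(ℝ, E) x) :=
  LinearMap.ker (β x).toLinearMap

/-- A smooth distribution of codimension one: locally the kernel of a nowhere vanishing
smooth one-form. -/
def IsCodimOne
    (ξ : ∀ x : M, Submodule ℝ (TangentSpace 𝓘(ℝ, E) x)) : Prop :=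
  ∀ x₀ : M, ∃ β : ∀ x : M, TangentSpace 𝓘(ℝ, E) x →L[ℝ] ℝ,
    IsSmoothForm β ∧ ∀ᶠ x in 𝓝 x₀, β x ≠ 0 ∧ ξ x = kerForm β x

/-- `V` belongs to `𝓗(ξ)`: it is a smooth vector field tangent to `ξ`. -/
def IsSection (ξ : ∀ x : M, Submodule ℝ (TangentSpace 𝓘(ℝ, E) x))
    (V : ∀ x : M, TangentSpace 𝓘(ℝ, E) x) : Prop :=
  IsSmoothField V ∧ ∀ x, V x ∈ ξ x

/-- Integrability of a distribution: `𝓗(ξ)` is closed under the Lie bracket. -/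
def IsIntegrable (ξ : ∀ x : M, Submodule ℝ (TangentSpace 𝓘(ℝ, E) x)) : Prop :=
  ∀ V W : ∀ x : M, TangentSpace 𝓘(ℝ, E) x, IsSection ξ V → IsSection ξ W →
    ∀ x, lie V W x ∈ ξ x

open Classical in
/-- The action of an endomorphism field `A` of `ξ` on vector fields tangent to `ξ`
(with value `0` at the points where the vector field is not tangent to `ξ`). -/
def act (ξ : ∀ x : M, Submodule ℝ (TangentSpace 𝓘(ℝ, E) x))
    (A : ∀ x : M, Module.End ℝ (ξ x)) (V : ∀ x : M, TangentSpace 𝓘(ℝ, E) x) :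
    ∀ x : M, TangentSpace 𝓘(ℝ, E) x :=
  fun x => if h : V x ∈ ξ x then (A x ⟨V x, h⟩ : TangentSpace 𝓘(ℝ, E) x) else 0

/-- An endomorphism field of `ξ` is smooth: it maps `𝓗(ξ)` to `𝓗(ξ)`. -/
def IsSmoothEnd (ξ : ∀ x : M, Submodule ℝ (TangentSpace 𝓘(ℝ, E) x))
    (A : ∀ x : M, Module.End ℝ (ξ x)) : Prop :=
  ∀ V : ∀ x : M, TangentSpace 𝓘(ℝ, E) x, IsSection ξ V → IsSection ξ (act ξ A V)

/-- A complex structure on the bundle `ξ`: a smooth endomorphism field `J` with `J² = -1`. -/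
def IsComplexStructure (ξ : ∀ x : M, Submodule ℝ (TangentSpace 𝓘(ℝ, E) x))
    (J : ∀ x : M, Module.End ℝ (ξ x)) : Prop :=
  IsSmoothEnd ξ J ∧ ∀ x (v : ξ x), J x (J x v) = -v

/-- A Levi flat structure: an integrable distribution `ξ` of codimension one together with
a complex structure `J` on `ξ` which is integrable along the leaves, i.e. whose Nijenhuis
tensor vanishes on vector fields tangent to `ξ`. -/
structure IsLeviFlat
    (ξ : ∀ x : M, Submodule ℝ (TangentSpace 𝓘(ℝ, E) x))
    (J : ∀ x : M, Module.End ℝ (ξ x)) : Prop where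
  codimOne : IsCodimOne ξ
  integrable : IsIntegrable ξ
  complexStructure : IsComplexStructure ξ J
  nijenhuis_eq_zero : ∀ V W : ∀ x : M, TangentSpace 𝓘(ℝ, E) x,
    IsSection ξ V → IsSection ξ W → nijenhuis lie (act ξ J) V W = 0

/-- A DGLA defining couple for `ξ`: a smooth one-form `γ` with kernel `ξ` and a smooth vector
field `X` with `γ(X) = 1`. -/
structure IsDefiningCouple
    (ξ : ∀ x : M, Submodule ℝ (TangentSpace 𝓘(ℝ, E) x))
    (γ : ∀ x : M, TangentSpace 𝓘(ℝ, E) x →L[ℝ] ℝ)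
    (X : ∀ x : M, TangentSpace 𝓘(ℝ, E) x) : Prop where
  smooth_form : IsSmoothForm γ
  smooth_field : IsSmoothField X
  ker_eq : ∀ x, ξ x = kerForm γ x
  apply_eq_one : ∀ x, γ x (X x) = 1

/-- `α ∈ 𝒵¹(M)`: a smooth one-form with `ι_X α = 0`. -/
structure IsZOne
    (X : ∀ x : M, TangentSpace 𝓘(ℝ, E) x)
    (α : ∀ x : M, TangentSpace 𝓘(ℝ, E) x →L[ℝ] ℝ) : Prop where
  smooth : IsSmoothForm α
  apply_eq_zero : ∀ x, α x (X x) = 0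

/-! ## The Maurer–Cartan equation

One-forms and two-forms are evaluated on vector fields. -/

/-- The function `α(V)`. -/
def evalForm (α : ∀ x : M, TangentSpace 𝓘(ℝ, E) x →L[ℝ] ℝ)
    (V : ∀ x : M, TangentSpace 𝓘(ℝ, E) x) (x : M) : ℝ :=
  α x (V x)

/-- The exterior derivative of a one-form: `dα(V,W) = V(α(W)) - W(α(V)) - α([V,W])`. -/
def extDer (α : ∀ x : M, TangentSpace 𝓘(ℝ, E) x →L[ℝ] ℝ)
    (V W : ∀ x : M, TangentSpace 𝓘(ℝ, E) x) (x : M) : ℝ :=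
  dirDeriv V (evalForm α W) x - dirDeriv W (evalForm α V) x - evalForm α (lie V W) x

/-- The Lie derivative of a one-form: `(𝓛_X α)(V) = X(α(V)) - α([X,V])`. -/
def lieDer (X : ∀ x : M, TangentSpace 𝓘(ℝ, E) x)
    (α : ∀ x : M, TangentSpace 𝓘(ℝ, E) x →L[ℝ] ℝ)
    (V : ∀ x : M, TangentSpace 𝓘(ℝ, E) x) (x : M) : ℝ :=
  dirDeriv X (evalForm α V) x - evalForm α (lie X V) x

/-- The wedge product of two one-forms: `(a ∧ b)(V,W) = a(V) b(W) - a(W) b(V)`. -/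
def wedge (a b : (∀ x : M, TangentSpace 𝓘(ℝ, E) x) → M → ℝ)
    (V W : ∀ x : M, TangentSpace 𝓘(ℝ, E) x) (x : M) : ℝ :=
  a V x * b W x - a W x * b V x

/-- The bracket of one-forms: `{α,β} = 𝓛_X α ∧ β - α ∧ 𝓛_X β`. -/
def formBracket (X : ∀ x : M, TangentSpace 𝓘(ℝ, E) x)
    (α β : ∀ x : M, TangentSpace 𝓘(ℝ, E) x →L[ℝ] ℝ)
    (V W : ∀ x : M, TangentSpace 𝓘(ℝ, E) x) (x : M) : ℝ :=
  wedge (lieDer X α) (evalForm β) V W x - wedge (evalForm α) (lieDer X β) V W x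

/-- `δα = dα + {γ,α}`. -/
def delta (γ : ∀ x : M, TangentSpace 𝓘(ℝ, E) x →L[ℝ] ℝ)
    (X : ∀ x : M, TangentSpace 𝓘(ℝ, E) x)
    (α : ∀ x : M, TangentSpace 𝓘(ℝ, E) x →L[ℝ] ℝ)
    (V W : ∀ x : M, TangentSpace 𝓘(ℝ, E) x) (x : M) : ℝ :=
  extDer α V W x + formBracket X γ α V W x

/-- The Maurer–Cartan equation `δα + ½{α,α} = 0`. -/
def MaurerCartan (γ : ∀ x : M, TangentSpace 𝓘(ℝ, E) x →L[ℝ] ℝ)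
    (X : ∀ x : M, TangentSpace 𝓘(ℝ, E) x)
    (α : ∀ x : M, TangentSpace 𝓘(ℝ, E) x →L[ℝ] ℝ) : Prop :=
  ∀ V W : ∀ x : M, TangentSpace 𝓘(ℝ, E) x, IsSmoothField V → IsSmoothField W →
    ∀ x, delta γ X α V W x + 1 / 2 * formBracket X α α V W x = 0

/-! ## The deformed bracket and the deformed complex structure -/

/-- `ω_α(V) = V - α(V) X` at a point. -/
def omega (X : ∀ x : M, TangentSpace 𝓘(ℝ, E) x)
    (α : ∀ x : M, TangentSpace 𝓘(ℝ, E) x →L[ℝ] ℝ) (x : M) (v : TangentSpace 𝓘(ℝ, E) x) :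
    TangentSpace 𝓘(ℝ, E) x :=
  v - α x v • X x

/-- `ω_α⁻¹(V) = V + α(V) X` at a point (the inverse of `ω_α` as soon as `α(X) = 0`). -/
def omegaInv (X : ∀ x : M, TangentSpace 𝓘(ℝ, E) x)
    (α : ∀ x : M, TangentSpace 𝓘(ℝ, E) x →L[ℝ] ℝ) (x : M) (v : TangentSpace 𝓘(ℝ, E) x) :
    TangentSpace 𝓘(ℝ, E) x :=
  v + α x v • X x

/-- The deformed bracket `[V,W]_α = ω_α⁻¹[ω_α V, ω_α W]`. -/
def lieDef (X : ∀ x : M, TangentSpace 𝓘(ℝ, E) x)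
    (α : ∀ x : M, TangentSpace 𝓘(ℝ, E) x →L[ℝ] ℝ)
    (V W : ∀ x : M, TangentSpace 𝓘(ℝ, E) x) : ∀ x : M, TangentSpace 𝓘(ℝ, E) x :=
  fun x => omegaInv X α x
    (lie (fun y => omega X α y (V y)) (fun y => omega X α y (W y)) x)

/-- The distribution `ξ_α = ker(γ + α)`. -/
def xiDef (γ α : ∀ x : M, TangentSpace 𝓘(ℝ, E) x →L[ℝ] ℝ) (x : M) :
    Submodule ℝ (TangentSpace 𝓘(ℝ, E) x) :=
  kerForm (fun y => γ y + α y) x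

/-- The isomorphism `ω_α : ξ → ξ_α`. -/
def omegaEquiv
    {ξ : ∀ x : M, Submodule ℝ (TangentSpace 𝓘(ℝ, E) x)}
    {γ α : ∀ x : M, TangentSpace 𝓘(ℝ, E) x →L[ℝ] ℝ} {X : ∀ x : M, TangentSpace 𝓘(ℝ, E) x}
    (hγ : IsDefiningCouple ξ γ X) (hα : IsZOne X α) (x : M) : ξ x ≃ₗ[ℝ] xiDef γ α x where
  toFun v := ⟨omega X α x v, by
    have hv : γ x v = 0 := by
      have h : (v : TangentSpace 𝓘(ℝ, E) x) ∈ kerForm γ x := (hγ.ker_eq x).le v.2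
      exact h
    change (γ x + α x) (omega X α x v) = 0
    simp [omega, hv, hγ.apply_eq_one x, hα.apply_eq_zero x]⟩
  invFun w := ⟨omegaInv X α x w, by
    have hw : γ x w + α x w = 0 := w.2
    rw [hγ.ker_eq x]
    change γ x (omegaInv X α x w) = 0
    simpa [omegaInv, hγ.apply_eq_one x] using hw⟩
  left_inv v := by
    ext
    simp [omega, omegaInv, hα.apply_eq_zero x]
  right_inv w := by
    ext
    simp [omega, omegaInv, hα.apply_eq_zero x]
  map_add' v w := by
    ext
    simp only [omega, Submodule.coe_add, map_add, add_smul]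
    abel
  map_smul' c v := by
    ext
    simp [omega, smul_sub, mul_smul]

/-- The form `S` belongs to `Λ^{0,1}_J(ξ) ⊗ ξ`: it is smooth and `S(JV) = -J S(V)`. -/
def IsForm01 (ξ : ∀ x : M, Submodule ℝ (TangentSpace 𝓘(ℝ, E) x))
    (J S : ∀ x : M, Module.End ℝ (ξ x)) : Prop :=
  IsSmoothEnd ξ S ∧ ∀ x (v : ξ x), S x (J x v) = -J x (S x v)

/-- The form `S ∈ Λ^{0,1}_J(ξ) ⊗ ξ` encodes the complex structure `Jα` of `ξ_α`: `I + S` is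
invertible and `ω_α⁻¹ Jα ω_α = (I + S) J (I + S)⁻¹`. -/
structure Encodes
    {ξ : ∀ x : M, Submodule ℝ (TangentSpace 𝓘(ℝ, E) x)}
    {γ α : ∀ x : M, TangentSpace 𝓘(ℝ, E) x →L[ℝ] ℝ} {X : ∀ x : M, TangentSpace 𝓘(ℝ, E) x}
    (hγ : IsDefiningCouple ξ γ X) (hα : IsZOne X α)
    (J : ∀ x : M, Module.End ℝ (ξ x)) (Jα : ∀ x : M, Module.End ℝ (xiDef γ α x))
    (S : ∀ x : M, Module.End ℝ (ξ x)) : Prop where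
  form01 : IsForm01 ξ J S
  isUnit : ∀ x, IsUnit (1 + S x)
  conj_eq : ∀ x, (omegaEquiv hγ hα x).symm.conj (Jα x) =
    (1 + S x) * J x * Ring.inverse (1 + S x)

/-- A complex structure `K` is of the form `(I + S) J (I + S)⁻¹` for at most one `S`
that anticommutes with `J`. -/
theorem conj_unique {V : Type*} [AddCommGroup V] [Module ℝ V] {J K S S' : Module.End ℝ V}
    (hJ : ∀ v, J (J v) = -v)
    (hS : ∀ v, S (J v) = -J (S v)) (uS : IsUnit (1 + S))
    (eS : K = (1 + S) * J * Ring.inverse (1 + S))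
    (hS' : ∀ v, S' (J v) = -J (S' v)) (uS' : IsUnit (1 + S'))
    (eS' : K = (1 + S') * J * Ring.inverse (1 + S')) : S = S' := by
  have key : ∀ {R : Module.End ℝ V}, (∀ v, R (J v) = -J (R v)) → IsUnit (1 + R) →
      K = (1 + R) * J * Ring.inverse (1 + R) → (K + J) * (1 + R) = 2 * J := by
    intro R hR uR eR
    have h0 : R * J = -(J * R) := LinearMap.ext hR
    have h1 : K * (1 + R) = (1 + R) * J := by
      rw [eR, mul_assoc, Ring.inverse_mul_cancel _ uR, mul_one]
    rw [add_mul, h1, add_mul, h0, mul_add, one_mul, mul_one, two_mul]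
    abel
  have hJJ : J * J = -1 := LinearMap.ext hJ
  have hJu : IsUnit J :=
    ⟨⟨J, -J, by rw [mul_neg, hJJ, neg_neg], by rw [neg_mul, hJJ, neg_neg]⟩, rfl⟩
  have h2 : IsUnit ((2 : Module.End ℝ V) * J) := by
    refine IsUnit.mul ?_ hJu
    have : (2 : Module.End ℝ V) = algebraMap ℝ (Module.End ℝ V) 2 := by
      rw [map_ofNat]
    rw [this]
    exact (IsUnit.mk0 (2 : ℝ) two_ne_zero).map _
  have h3 : IsUnit (K + J) := by
    rw [← key hS uS eS] at h2
    obtain ⟨u, hu⟩ := uS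
    rw [← hu] at h2
    exact (Units.isUnit_mul_units _ u).1 h2
  have e : (K + J) * (1 + S) = (K + J) * (1 + S') := by
    rw [key hS uS eS, key hS' uS' eS']
  exact add_left_cancel (h3.mul_left_cancel e)

/-- A complex structure of `ξ_α` is encoded by at most one form. -/
theorem Encodes.unique
    {ξ : ∀ x : M, Submodule ℝ (TangentSpace 𝓘(ℝ, E) x)}
    {γ α : ∀ x : M, TangentSpace 𝓘(ℝ, E) x →L[ℝ] ℝ} {X : ∀ x : M, TangentSpace 𝓘(ℝ, E) x}
    {hγ : IsDefiningCouple ξ γ X} {hα : IsZOne X α}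
    {J : ∀ x : M, Module.End ℝ (ξ x)} {Jα : ∀ x : M, Module.End ℝ (xiDef γ α x)}
    (hJ : IsComplexStructure ξ J) {S S' : ∀ x : M, Module.End ℝ (ξ x)}
    (h : Encodes hγ hα J Jα S) (h' : Encodes hγ hα J Jα S') : S = S' := by
  funext x
  exact conj_unique (hJ.2 x) (h.form01.2 x) (h.isUnit x) (h.conj_eq x) (h'.form01.2 x)
    (h'.isUnit x) (h'.conj_eq x)

/-! ## The `(0,1)`-form of a defining couple -/

/-- `T(V) = [V,X] - γ([V,X]) X`. -/
def torsionT (γ : ∀ x : M, TangentSpace 𝓘(ℝ, E) x →L[ℝ] ℝ)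
    (X V : ∀ x : M, TangentSpace 𝓘(ℝ, E) x) : ∀ x : M, TangentSpace 𝓘(ℝ, E) x :=
  fun x => lie V X x - γ x (lie V X x) • X x

/-- `H(V) = ½ (T(V) + J T(JV))`. -/
def formH (ξ : ∀ x : M, Submodule ℝ (TangentSpace 𝓘(ℝ, E) x))
    (J : ∀ x : M, Module.End ℝ (ξ x))
    (γ : ∀ x : M, TangentSpace 𝓘(ℝ, E) x →L[ℝ] ℝ)
    (X V : ∀ x : M, TangentSpace 𝓘(ℝ, E) x) : ∀ x : M, TangentSpace 𝓘(ℝ, E) x :=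
  (1 / 2 : ℝ) • (torsionT γ X V + act ξ J (torsionT γ X (act ξ J V)))

/-- The complex valued form `α^{0,1}(V) = ½ (α(V) + i α(JV))`. -/
def part01 (ξ : ∀ x : M, Submodule ℝ (TangentSpace 𝓘(ℝ, E) x))
    (J : ∀ x : M, Module.End ℝ (ξ x))
    (α : ∀ x : M, TangentSpace 𝓘(ℝ, E) x →L[ℝ] ℝ)
    (V : ∀ x : M, TangentSpace 𝓘(ℝ, E) x) (x : M) : ℂ :=
  1 / 2 * ((evalForm α V x : ℂ) + Complex.I * (evalForm α (act ξ J V) x : ℂ))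

/-- Multiplication of a vector field tangent to `ξ` by a complex function, with `i` acting
on `ξ` as `J`. -/
def cmul (ξ : ∀ x : M, Submodule ℝ (TangentSpace 𝓘(ℝ, E) x))
    (J : ∀ x : M, Module.End ℝ (ξ x)) (z : M → ℂ)
    (Z : ∀ x : M, TangentSpace 𝓘(ℝ, E) x) : ∀ x : M, TangentSpace 𝓘(ℝ, E) x :=
  fun x => (z x).re • Z x + (z x).im • act ξ J Z x

/-- `(α^{0,1} ∧ H)(V,W) = α^{0,1}(V) H(W) - α^{0,1}(W) H(V)`. -/
def wedgeH (ξ : ∀ x : M, Submodule ℝ (TangentSpace 𝓘(ℝ, E) x))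
    (J : ∀ x : M, Module.End ℝ (ξ x))
    (γ : ∀ x : M, TangentSpace 𝓘(ℝ, E) x →L[ℝ] ℝ)
    (X : ∀ x : M, TangentSpace 𝓘(ℝ, E) x)
    (α : ∀ x : M, TangentSpace 𝓘(ℝ, E) x →L[ℝ] ℝ)
    (V W : ∀ x : M, TangentSpace 𝓘(ℝ, E) x) : ∀ x : M, TangentSpace 𝓘(ℝ, E) x :=
  cmul ξ J (part01 ξ J α V) (formH ξ J γ X W) - cmul ξ J (part01 ξ J α W) (formH ξ J γ X V)

end LeviFlat

end

/-! The two conditions are handled one after the other. If `β(X) = 1`, then `V ↦ V - β(V) X`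
projects onto `ker β`, and `-β` of the bracket of two projected fields is `(dβ + 𝓛_X β ∧ β)(V,W)`;
hence `ker β` is integrable exactly when this two-form vanishes. The Maurer–Cartan expression is the
difference of these two-forms for `γ + α` and for `γ`, and the second is zero because `ξ` is
integrable (`maurerCartan_iff`).

Once `ξ_α` is integrable, `ω_α` transports the question to `𝓗(ξ)` with the bracket `[·,·]_α` and the
operator `K = (I + S) J (I + S)⁻¹`. For any biadditive antisymmetric bracket, with no Jacobi
identity, `-4 (∂̄S + ½[[S,S]] - ¼ N_J)(V,W) = (I - S) N_K((I + S)V, (I + S)W)`. Since `I + S` is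
bijective and `I - S` injective, the deformation equation says `N_K = 0` (`nijenhuis_eq_zero_iff`,
`nijenhuis_xiDef_iff`).

The equality `¼ N_J = -α^{0,1} ∧ H` is then automatic: `[V,W]_α` is `[V,W]` plus terms in `T`, and
the leafwise integrability of `J` removes the undeformed brackets (`nijenhuis_lieDef`). -/

noncomputable section

namespace LeviFlat

/-! ### The algebraic identity behind the deformation equation -/

section Algebra

variable {g : Type*} [AddCommGroup g] [Module ℝ g]

/-- The deformation equation is, up to an invertible factor, the Nijenhuis tensor of the
deformed complex structure evaluated on `(V + SV, W + SW)`. -/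
theorem deformation_eq (br : g → g → g)
    (add_left : ∀ U V W, br (U + V) W = br U W + br V W)
    (anti : ∀ V W, br V W = -br W V) (J S : g →ₗ[ℝ] g)
    (hS : ∀ v, S (J v) = -J (S v)) (V W : g) :
    (-4 : ℝ) • (dbarOne br J S V W + (1 / 2 : ℝ) • doubleBracket br J S V W
        - (1 / 4 : ℝ) • nijenhuis br J V W) =
      (br (J V + S (J V)) (J W + S (J W)) - br (V + S V) (W + S W)
        - S (br (J V + S (J V)) (J W + S (J W)) - br (V + S V) (W + S W)))
      - (J (br (J V + S (J V)) (W + S W) + br (V + S V) (J W + S (J W)))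
        + S (J (br (J V + S (J V)) (W + S W) + br (V + S V) (J W + S (J W))))) := by
  have add_right : ∀ U V W, br U (V + W) = br U V + br U W := fun U V W => by
    rw [anti, add_left, anti U, anti U]; abel
  have zero_left : ∀ W, br 0 W = 0 := fun W => by simpa using add_left 0 0 W
  have neg_left : ∀ V W, br (-V) W = -br V W := fun V W => by
    rw [eq_neg_iff_add_eq_zero, ← add_left, neg_add_cancel, zero_left]
  have neg_right : ∀ V W, br V (-W) = -br V W := fun V W => by
    rw [anti, neg_left, anti V, neg_neg]
  simp only [dbarOne, doubleBracket, selfBracket, nijenhuis, dbar]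
  -- The term `∂̄(SV)(W)` produces brackets with `W` first; they are reoriented to match the rest.
  rw [anti W (S V), anti (J W) (S V), anti (J W) (J (S V)), anti W (J (S V))]
  simp only [map_add, map_sub, map_neg, add_left, add_right, neg_left, neg_right, hS]
  module

/-- A deformed complex structure `K = (I + S) J (I + S)⁻¹` is integrable if and only if `S`
satisfies the deformation equation. -/
theorem nijenhuis_eq_zero_iff (br : g → g → g)
    (add_left : ∀ U V W, br (U + V) W = br U W + br V W)
    (anti : ∀ V W, br V W = -br W V) (J S K : g →ₗ[ℝ] g)
    (hJ : ∀ v, J (J v) = -v) (hS : ∀ v, S (J v) = -J (S v))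
    (inj : ∀ v, v + S v = 0 → v = 0) (surj : ∀ w, ∃ v, w = v + S v)
    (hK : ∀ v, K (v + S v) = J v + S (J v)) :
    (∀ V W, nijenhuis br K V W = 0) ↔
      ∀ V W, dbarOne br J S V W + (1 / 2 : ℝ) • doubleBracket br J S V W
        = (1 / 4 : ℝ) • nijenhuis br J V W := by
  have key : ∀ V W, (-4 : ℝ) • (dbarOne br J S V W + (1 / 2 : ℝ) • doubleBracket br J S V W
        - (1 / 4 : ℝ) • nijenhuis br J V W) =
      nijenhuis br K (V + S V) (W + S W) - S (nijenhuis br K (V + S V) (W + S W)) := by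
    intro V W
    -- `(I - S) K = (I + S) J`: applied to `(I + S) w`, both sides are `(I - S²) J w`.
    have twist : ∀ v, K v - S (K v) = J v + S (J v) := by
      intro v
      obtain ⟨w, rfl⟩ := surj v
      rw [hK]
      simp only [map_add, map_neg, hS]
      abel
    rw [deformation_eq br add_left anti J S hS]
    have h := twist (br (J V + S (J V)) (W + S W) + br (V + S V) (J W + S (J W)))
    rw [← h]
    simp only [nijenhuis, hK, map_add, map_sub]
    abel
  -- `I - S` inherits injectivity from `I + S` through `(I + S) J = J (I - S)`.
  have inj' : ∀ v, v - S v = 0 → v = 0 := by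
    intro v hv
    have h : J v + S (J v) = 0 := by rw [hS, ← sub_eq_add_neg, ← map_sub, hv, map_zero]
    have h' := hJ v
    rw [inj _ h, map_zero] at h'
    exact neg_eq_zero.1 h'.symm
  constructor
  · intro h V W
    have := key V W
    rw [h, map_zero, sub_zero, smul_eq_zero] at this
    exact sub_eq_zero.1 (this.resolve_left (by norm_num))
  · intro h V W
    obtain ⟨V, rfl⟩ := surj V
    obtain ⟨W, rfl⟩ := surj W
    refine inj' _ ?_
    rw [← key, h, sub_self, smul_zero]

end Algebra

variable {E : Type*} [NormedAddCommGroup E] [NormedSpace ℝ E]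
variable {M : Type*} [TopologicalSpace M] [ChartedSpace E M]
  [IsManifold 𝓘(ℝ, E) ∞ M]

/-! ## Smooth fields, forms and brackets -/

section Smooth

variable {V W X : ∀ x : M, TangentSpace 𝓘(ℝ, E) x}
  {α β γ : ∀ x : M, TangentSpace 𝓘(ℝ, E) x →L[ℝ] ℝ} {f h : M → ℝ}

theorem IsSmoothField.add (hV : IsSmoothField V) (hW : IsSmoothField W) :
    IsSmoothField (V + W) :=
  ContMDiff.add_section hV hW

theorem IsSmoothField.sub (hV : IsSmoothField V) (hW : IsSmoothField W) :
    IsSmoothField (V - W) :=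
  ContMDiff.sub_section hV hW

theorem IsSmoothField.smul (hf : ContMDiff 𝓘(ℝ, E) 𝓘(ℝ, ℝ) ∞ f) (hV : IsSmoothField V) :
    IsSmoothField (f • V) :=
  ContMDiff.smul_section hf hV

theorem IsSmoothField.const_smul (c : ℝ) (hV : IsSmoothField V) : IsSmoothField (c • V) :=
  IsSmoothField.smul (f := fun _ => c) contMDiff_const hV

theorem isSmoothField_zero : IsSmoothField (0 : ∀ x : M, TangentSpace 𝓘(ℝ, E) x) :=
  Bundle.contMDiff_zeroSection ℝ _

theorem IsSmoothField.mdifferentiableAt (hV : IsSmoothField V) (x : M) :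
    MDifferentiableAt 𝓘(ℝ, E) 𝓘(ℝ, E).tangent
      (fun x => (⟨x, V x⟩ : TangentBundle 𝓘(ℝ, E) M)) x :=
  (hV x).mdifferentiableAt (by simp)

theorem IsSmoothField.lie [CompleteSpace E] (hV : IsSmoothField V) (hW : IsSmoothField W) :
    IsSmoothField (lie V W) := fun x => by
  have : IsManifold 𝓘(ℝ, E) (minSmoothness ℝ 2) M :=
    .of_le (n := ∞) (by rw [minSmoothness_of_isRCLikeNormedField]; norm_cast)
  have : IsManifold 𝓘(ℝ, E) (((⊤ : ℕ∞) : WithTop ℕ∞) + 1) M := .of_le (n := ∞) (by norm_cast)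
  exact ContMDiffAt.mlieBracket_vectorField (m := ⊤) (n := ⊤) (hV x) (hW x) (by simp)

theorem IsSmoothForm.add (hα : IsSmoothForm α) (hβ : IsSmoothForm β) :
    IsSmoothForm (fun x => α x + β x) :=
  ContMDiff.add_section hα hβ

theorem IsSmoothForm.eval (hα : IsSmoothForm α) (hV : IsSmoothField V) :
    ContMDiff 𝓘(ℝ, E) 𝓘(ℝ, ℝ) ∞ (evalForm α V) := by
  have h := ContMDiff.clm_bundle_apply (F₂ := ℝ) (E₂ := Bundle.Trivial M ℝ) hα hV
  exact fun x => (Bundle.contMDiffAt_section _).1 (h x)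

theorem lie_add_left [CompleteSpace E] {U : ∀ x : M, TangentSpace 𝓘(ℝ, E) x}
    (hU : IsSmoothField U) (hV : IsSmoothField V) : lie (U + V) W = lie U W + lie V W := by
  have : IsManifold 𝓘(ℝ, E) 2 M := .of_le (n := ∞) (by norm_cast)
  funext x
  exact VectorField.mlieBracket_add_left (hU.mdifferentiableAt x) (hV.mdifferentiableAt x)

omit [IsManifold 𝓘(ℝ, E) ∞ M] in
theorem dirDeriv_add (hf : ContMDiff 𝓘(ℝ, E) 𝓘(ℝ, ℝ) ∞ f) (hh : ContMDiff 𝓘(ℝ, E) 𝓘(ℝ, ℝ) ∞ h)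
    (x : M) : dirDeriv V (f + h) x = dirDeriv V f x + dirDeriv V h x := by
  have := mfderiv_add ((hf x).mdifferentiableAt (by simp)) ((hh x).mdifferentiableAt (by simp))
  unfold dirDeriv
  rw [this]
  rfl

/-- The Leibniz rule for the bracket of `V - f X` and `W - h X`. -/
theorem lie_sub_smul [CompleteSpace E] (hV : IsSmoothField V) (hW : IsSmoothField W)
    (hX : IsSmoothField X)
    (hf : ContMDiff 𝓘(ℝ, E) 𝓘(ℝ, ℝ) ∞ f) (hh : ContMDiff 𝓘(ℝ, E) 𝓘(ℝ, ℝ) ∞ h) (x : M) :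
    lie (V - f • X) (W - h • X) x = lie V W x - h x • lie V X x + f x • lie W X x
      - (dirDeriv V h x - dirDeriv W f x - f x * dirDeriv X h x + h x * dirDeriv X f x)
        • X x := by
  have : IsManifold 𝓘(ℝ, E) 2 M := .of_le (n := ∞) (by norm_cast)
  have hf' := (hf x).mdifferentiableAt (by simp)
  have hh' := (hh x).mdifferentiableAt (by simp)
  have sub_left : ∀ {A B C : ∀ x : M, TangentSpace 𝓘(ℝ, E) x}, IsSmoothField A →
      IsSmoothField B → lie (A - B) C x = lie A C x - lie B C x := fun {A B C} hA hB => by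
    have h := congrFun (lie_add_left (W := C) (hA.sub hB) hB) x
    rw [sub_add_cancel] at h
    rw [h, Pi.add_apply, add_sub_cancel_right]
  have sub_right : ∀ {A B C : ∀ x : M, TangentSpace 𝓘(ℝ, E) x}, IsSmoothField A →
      IsSmoothField B → lie C (A - B) x = lie C A x - lie C B x := fun {A B C} hA hB => by
    rw [lie, VectorField.mlieBracket_swap_apply, ← lie, sub_left hA hB, lie, lie,
      VectorField.mlieBracket_swap_apply, VectorField.mlieBracket_swap_apply (V := B)]
    abel
  have hXX : lie X X x = 0 := by simp
  have e1 : ∀ {A : ∀ x : M, TangentSpace 𝓘(ℝ, E) x},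
      lie A (h • X) x = dirDeriv A h x • X x + h x • lie A X x := fun {A} =>
    VectorField.mlieBracket_smul_right hh' (hX.mdifferentiableAt x)
  have e2 : ∀ {A : ∀ x : M, TangentSpace 𝓘(ℝ, E) x},
      lie (f • X) A x = -dirDeriv A f x • X x + f x • lie X A x := fun {A} =>
    VectorField.mlieBracket_smul_left hf' (hX.mdifferentiableAt x)
  have e3 : dirDeriv (f • X) h x = f x * dirDeriv X h x :=
    map_smul (mfderiv 𝓘(ℝ, E) 𝓘(ℝ, ℝ) h x) (f x) (X x)
  have e4 : lie X W x = -lie W X x := VectorField.mlieBracket_swap_apply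
  rw [sub_left hV (hX.smul hf), sub_right hW (hX.smul hh), sub_right hW (hX.smul hh), e1, e1, e2,
    e2, e3, e4, hXX]
  module

end Smooth

/-! ## The Maurer–Cartan equation and integrability -/

section MaurerCartan

variable {X : ∀ x : M, TangentSpace 𝓘(ℝ, E) x}
  {α β γ : ∀ x : M, TangentSpace 𝓘(ℝ, E) x →L[ℝ] ℝ}

/-- The two-form `dβ + 𝓛_X β ∧ β`. -/
def obstruction (X : ∀ x : M, TangentSpace 𝓘(ℝ, E) x)
    (β : ∀ x : M, TangentSpace 𝓘(ℝ, E) x →L[ℝ] ℝ)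
    (V W : ∀ x : M, TangentSpace 𝓘(ℝ, E) x) (x : M) : ℝ :=
  extDer β V W x + wedge (lieDer X β) (evalForm β) V W x

theorem isSection_sub_smul (hX : IsSmoothField X) (hβ : IsSmoothForm β)
    (hβX : ∀ x, β x (X x) = 1) {V : ∀ x : M, TangentSpace 𝓘(ℝ, E) x} (hV : IsSmoothField V) :
    IsSection (kerForm β) (V - evalForm β V • X) := by
  refine ⟨hV.sub (hX.smul (hβ.eval hV)), fun x => ?_⟩
  change β x (V x - β x (V x) • X x) = 0
  simp [hβX]

/-- The Leibniz rule turns the `X`-component of the bracket into derivatives of `β(V)` and `β(W)`;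
applying `β` with `β(X) = 1` makes these the terms of `dβ` and `𝓛_X β ∧ β`. -/
theorem obstruction_eq [CompleteSpace E] (hX : IsSmoothField X) (hβ : IsSmoothForm β)
    (hβX : ∀ x, β x (X x) = 1) {V W : ∀ x : M, TangentSpace 𝓘(ℝ, E) x}
    (hV : IsSmoothField V) (hW : IsSmoothField W) (x : M) :
    obstruction X β V W x =
      -β x (lie (V - evalForm β V • X) (W - evalForm β W • X) x) := by
  rw [lie_sub_smul hV hW hX (hβ.eval hV) (hβ.eval hW)]
  have e1 : lie X V x = -lie V X x := VectorField.mlieBracket_swap_apply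
  have e2 : lie X W x = -lie W X x := VectorField.mlieBracket_swap_apply
  simp only [obstruction, extDer, wedge, lieDer, e1, e2, evalForm, map_sub, map_add, map_smul,
    map_neg, hβX, smul_eq_mul]
  ring

/-- A transverse one-form has integrable kernel if and only if `dβ + 𝓛_X β ∧ β = 0`. -/
theorem isIntegrable_kerForm_iff [CompleteSpace E] (hX : IsSmoothField X) (hβ : IsSmoothForm β)
    (hβX : ∀ x, β x (X x) = 1) :
    IsIntegrable (kerForm β) ↔ ∀ V W : ∀ x : M, TangentSpace 𝓘(ℝ, E) x,
      IsSmoothField V → IsSmoothField W → ∀ x, obstruction X β V W x = 0 := by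
  constructor
  · intro h V W hV hW x
    rw [obstruction_eq hX hβ hβX hV hW, neg_eq_zero]
    exact h _ _ (isSection_sub_smul hX hβ hβX hV) (isSection_sub_smul hX hβ hβX hW) x
  · intro h V W hV hW x
    -- The projection along `X` fixes fields already tangent to `ker β`.
    have eq_self : ∀ {V : ∀ x : M, TangentSpace 𝓘(ℝ, E) x}, IsSection (kerForm β) V →
        V - evalForm β V • X = V := fun {V} hV => by
      funext y
      have : β y (V y) = 0 := hV.2 y
      simp [evalForm, this]
    have := h V W hV.1 hW.1 x
    rw [obstruction_eq hX hβ hβX hV.1 hW.1, neg_eq_zero, eq_self hV, eq_self hW] at this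
    exact this

theorem extDer_add (hα : IsSmoothForm α) (hγ : IsSmoothForm γ)
    {V W : ∀ x : M, TangentSpace 𝓘(ℝ, E) x} (hV : IsSmoothField V) (hW : IsSmoothField W) (x : M) :
    extDer (fun x => γ x + α x) V W x = extDer γ V W x + extDer α V W x := by
  have e1 := dirDeriv_add (V := W) (hγ.eval hV) (hα.eval hV) x
  have e2 := dirDeriv_add (V := V) (hγ.eval hW) (hα.eval hW) x
  change dirDeriv V (evalForm γ W + evalForm α W) x - dirDeriv W (evalForm γ V + evalForm α V) x
    - (γ x (lie V W x) + α x (lie V W x)) = _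
  rw [e1, e2]
  simp only [extDer, evalForm]
  ring

theorem lieDer_add (hα : IsSmoothForm α) (hγ : IsSmoothForm γ)
    {V : ∀ x : M, TangentSpace 𝓘(ℝ, E) x} (hV : IsSmoothField V) (x : M) :
    lieDer X (fun x => γ x + α x) V x = lieDer X γ V x + lieDer X α V x := by
  have e1 := dirDeriv_add (V := X) (hγ.eval hV) (hα.eval hV) x
  change dirDeriv X (evalForm γ V + evalForm α V) x - (γ x (lie X V x) + α x (lie X V x)) = _
  rw [e1]
  simp only [lieDer, evalForm]
  ring

/-- In `𝓛_X β ∧ β` with `β = γ + α`, the cross terms form `{γ,α}` and the term quadratic in `α` is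
`½{α,α}`. -/
theorem delta_add_formBracket (hα : IsSmoothForm α) (hγ : IsSmoothForm γ)
    {V W : ∀ x : M, TangentSpace 𝓘(ℝ, E) x} (hV : IsSmoothField V) (hW : IsSmoothField W) (x : M) :
    delta γ X α V W x + 1 / 2 * formBracket X α α V W x =
      obstruction X (fun x => γ x + α x) V W x - obstruction X γ V W x := by
  simp only [obstruction, extDer_add hα hγ hV hW, wedge, lieDer_add hα hγ hV, lieDer_add hα hγ hW,
    delta, formBracket, evalForm, add_apply]
  ring

theorem maurerCartan_iff [CompleteSpace E]
    {ξ : ∀ x : M, Submodule ℝ (TangentSpace 𝓘(ℝ, E) x)} (hξ : IsIntegrable ξ)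
    (hγ : IsDefiningCouple ξ γ X) (hα : IsZOne X α) :
    MaurerCartan γ X α ↔ IsIntegrable (xiDef γ α) := by
  obtain rfl : ξ = kerForm γ := funext hγ.ker_eq
  have h := (isIntegrable_kerForm_iff hγ.smooth_field hγ.smooth_form hγ.apply_eq_one).1 hξ
  have e : xiDef γ α = kerForm (fun x => γ x + α x) := rfl
  rw [e, isIntegrable_kerForm_iff hγ.smooth_field (hγ.smooth_form.add hα.smooth)
    (fun x => by simp [hγ.apply_eq_one, hα.apply_eq_zero])]
  refine forall_congr' fun V => forall_congr' fun W => forall_congr' fun hV =>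
    forall_congr' fun hW => forall_congr' fun x => ?_
  rw [delta_add_formBracket hα.smooth hγ.smooth_form hV hW, h V W hV hW, sub_zero]

theorem isCodimOne_xiDef {ξ : ∀ x : M, Submodule ℝ (TangentSpace 𝓘(ℝ, E) x)}
    (hγ : IsDefiningCouple ξ γ X) (hα : IsZOne X α) : IsCodimOne (xiDef γ α) := fun _ =>
  ⟨fun x => γ x + α x, hγ.smooth_form.add hα.smooth, .of_forall fun x => ⟨fun h => by
    -- `γ + α` takes the value `1` on `X`, so it vanishes nowhere.
    have := congrArg (fun l => l (X x)) h
    simp [hγ.apply_eq_one, hα.apply_eq_zero] at this, rfl⟩⟩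

end MaurerCartan

/-! ## The modules of sections -/

section Sections

variable {ξ : ∀ x : M, Submodule ℝ (TangentSpace 𝓘(ℝ, E) x)} {A J : ∀ x : M, Module.End ℝ (ξ x)}
  {γ α : ∀ x : M, TangentSpace 𝓘(ℝ, E) x →L[ℝ] ℝ} {X : ∀ x : M, TangentSpace 𝓘(ℝ, E) x}

/-- The space `𝓗(ξ)`. -/
def sections (ξ : ∀ x : M, Submodule ℝ (TangentSpace 𝓘(ℝ, E) x)) :
    Submodule ℝ (∀ x : M, TangentSpace 𝓘(ℝ, E) x) where
  carrier := {V | IsSection ξ V}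
  add_mem' hV hW := ⟨hV.1.add hW.1, fun x => (ξ x).add_mem (hV.2 x) (hW.2 x)⟩
  zero_mem' := ⟨isSmoothField_zero, fun x => (ξ x).zero_mem⟩
  smul_mem' c _ hV := ⟨hV.1.const_smul c, fun x => (ξ x).smul_mem c (hV.2 x)⟩

omit [IsManifold 𝓘(ℝ, E) ∞ M] in
theorem act_apply {V : ∀ x : M, TangentSpace 𝓘(ℝ, E) x} {x : M} {v : ξ x} (h : V x = v) :
    act ξ A V x = A x v := by
  have h' : V x ∈ ξ x := h ▸ v.2
  obtain rfl : ⟨V x, h'⟩ = v := Subtype.ext h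
  simp [act, h']

/-- The operator on `𝓗(ξ)` given by a smooth endomorphism field. -/
def actSections (hA : IsSmoothEnd ξ A) : sections ξ →ₗ[ℝ] sections ξ where
  toFun V := ⟨act ξ A V, hA V V.2⟩
  map_add' V W := by
    ext1
    funext x
    change act ξ A (V.1 + W.1) x = act ξ A V x + act ξ A W x
    rw [act_apply (v := ⟨V.1 x, V.2.2 x⟩ + ⟨W.1 x, W.2.2 x⟩) rfl,
      act_apply (V := V) (v := ⟨V.1 x, V.2.2 x⟩) rfl,
      act_apply (V := W) (v := ⟨W.1 x, W.2.2 x⟩) rfl, map_add, Submodule.coe_add]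
  map_smul' c V := by
    ext1
    funext x
    change act ξ A (c • V.1) x = c • act ξ A V x
    rw [act_apply (v := c • ⟨V.1 x, V.2.2 x⟩) rfl,
      act_apply (V := V) (v := ⟨V.1 x, V.2.2 x⟩) rfl, map_smul, Submodule.coe_smul]

/-- The value of a section at a point. -/
def evalSections (x : M) : sections ξ →ₗ[ℝ] ξ x where
  toFun V := ⟨V.1 x, V.2.2 x⟩
  map_add' _ _ := rfl
  map_smul' _ _ := rfl

theorem sections_ext {V W : sections ξ} (h : ∀ x, evalSections x V = evalSections x W) :
    V = W := by
  ext1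
  funext x
  exact congrArg Subtype.val (h x)

theorem evalSections_act (hA : IsSmoothEnd ξ A) (V : sections ξ) (x : M) :
    evalSections x (actSections hA V) = A x (evalSections x V) :=
  Subtype.ext (act_apply rfl)

/-- The isomorphism `ω_α : 𝓗(ξ) → 𝓗(ξ_α)`. -/
def omegaSections (hγ : IsDefiningCouple ξ γ X) (hα : IsZOne X α) :
    sections ξ ≃ₗ[ℝ] sections (xiDef γ α) where
  toFun V := ⟨fun x => omega X α x (V.1 x),
    V.2.1.sub (hγ.smooth_field.smul (hα.smooth.eval V.2.1)),
    fun x => (omegaEquiv hγ hα x ⟨V.1 x, V.2.2 x⟩).2⟩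
  invFun V := ⟨fun x => omegaInv X α x (V.1 x),
    V.2.1.add (hγ.smooth_field.smul (hα.smooth.eval V.2.1)),
    fun x => ((omegaEquiv hγ hα x).symm ⟨V.1 x, V.2.2 x⟩).2⟩
  left_inv V := by
    ext1
    funext x
    exact congrArg Subtype.val ((omegaEquiv hγ hα x).symm_apply_apply ⟨V.1 x, V.2.2 x⟩)
  right_inv V := by
    ext1
    funext x
    exact congrArg Subtype.val ((omegaEquiv hγ hα x).apply_symm_apply ⟨V.1 x, V.2.2 x⟩)
  map_add' V W := by
    ext1
    funext x
    exact congrArg Subtype.val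
      (map_add (omegaEquiv hγ hα x) ⟨V.1 x, V.2.2 x⟩ ⟨W.1 x, W.2.2 x⟩)
  map_smul' c V := by
    ext1
    funext x
    exact congrArg Subtype.val (map_smul (omegaEquiv hγ hα x) c ⟨V.1 x, V.2.2 x⟩)

/-- The Lie bracket on `𝓗(ξ)` for an integrable distribution. -/
def lieSections [CompleteSpace E] (hξ : IsIntegrable ξ) (V W : sections ξ) : sections ξ :=
  ⟨lie V.1 W.1, V.2.1.lie W.2.1, hξ _ _ V.2 W.2⟩

/-- The deformed bracket `[V,W]_α` on `𝓗(ξ)`. -/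
def lieDefSections [CompleteSpace E] (hγ : IsDefiningCouple ξ γ X) (hα : IsZOne X α)
    (h : IsIntegrable (xiDef γ α)) (V W : sections ξ) : sections ξ :=
  (omegaSections hγ hα).symm (lieSections h (omegaSections hγ hα V) (omegaSections hγ hα W))

/-! ### Transport of the Nijenhuis tensor by `ω_α` -/

/-- The Nijenhuis tensor of `J_α` corresponds under `ω_α` to that of `ω_α⁻¹ J_α ω_α` with respect
to the deformed bracket, so `J_α` is integrable if and only if `S` solves the deformation
equation. -/
theorem nijenhuis_xiDef_iff [CompleteSpace E] (hJ : IsComplexStructure ξ J)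
    (hγ : IsDefiningCouple ξ γ X) (hα : IsZOne X α) {Jα : ∀ x : M, Module.End ℝ (xiDef γ α x)}
    (hJα : IsSmoothEnd (xiDef γ α) Jα) {S : ∀ x : M, Module.End ℝ (ξ x)}
    (hS : Encodes hγ hα J Jα S) (h : IsIntegrable (xiDef γ α)) :
    (∀ V W : ∀ x : M, TangentSpace 𝓘(ℝ, E) x, IsSection (xiDef γ α) V →
      IsSection (xiDef γ α) W → nijenhuis lie (act (xiDef γ α) Jα) V W = 0) ↔
    ∀ V W : ∀ x : M, TangentSpace 𝓘(ℝ, E) x, IsSection ξ V → IsSection ξ W →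
      dbarOne (lieDef X α) (act ξ J) (act ξ S) V W
            + (1 / 2 : ℝ) • doubleBracket (lieDef X α) (act ξ J) (act ξ S) V W
          = (1 / 4 : ℝ) • nijenhuis (lieDef X α) (act ξ J) V W := by
  set Ω := omegaSections hγ hα with hΩ
  set j := actSections hJ.1 with hj
  set s := actSections hS.form01.1 with hs
  set jα := actSections hJα with hjα
  set K : sections ξ →ₗ[ℝ] sections ξ := Ω.symm.toLinearMap ∘ₗ jα ∘ₗ Ω.toLinearMap with hKdef
  have eval_omega : ∀ v x, evalSections x (Ω v) = omegaEquiv hγ hα x (evalSections x v) :=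
    fun _ _ => rfl
  have eval_omega_symm : ∀ v x,
      evalSections x (Ω.symm v) = (omegaEquiv hγ hα x).symm (evalSections x v) := fun _ _ => rfl
  have hjj : ∀ v, j (j v) = -v := fun v => sections_ext fun x => by
    rw [hj, evalSections_act, evalSections_act, hJ.2, map_neg]
  have hsj : ∀ v, s (j v) = -j (s v) := fun v => sections_ext fun x => by
    rw [map_neg, hs, hj, evalSections_act, evalSections_act, evalSections_act, evalSections_act,
      hS.form01.2]
  have eval_K : ∀ v x u, evalSections x v = u + S x u →
      evalSections x (K v) = J x u + S x (J x u) := by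
    intro v x u hu
    -- Multiplying the encoding relation on the right by `1 + S x` removes the inverse.
    have c := congrArg (fun l => (l * (1 + S x)) u) (hS.conj_eq x)
    simp only [mul_assoc, Ring.inverse_mul_cancel _ (hS.isUnit x), mul_one] at c
    have e : evalSections x (K v) =
        (omegaEquiv hγ hα x).symm.conj (Jα x) (evalSections x v) := by
      change evalSections x (Ω.symm (jα (Ω v))) = _
      rw [eval_omega_symm, hjα, evalSections_act, eval_omega]
      rfl
    rw [e, hu]
    exact c
  have hK : ∀ v, K (v + s v) = j v + s (j v) := fun v => sections_ext fun x => by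
    rw [eval_K (v + s v) x (evalSections x v) (by rw [map_add, hs, evalSections_act]), map_add, hs,
      evalSections_act, hj, evalSections_act, evalSections_act]
  have inj_fiber : ∀ x (u : ξ x), u + S x u = 0 → u = 0 := fun x u hu => by
    have := congrArg (fun l => l u) (Ring.inverse_mul_cancel _ (hS.isUnit x))
    simp only [Module.End.mul_apply, LinearMap.add_apply, Module.End.one_apply, hu,
      map_zero] at this
    exact this.symm
  have inj : ∀ v, v + s v = 0 → v = 0 := fun v hv => sections_ext fun x => by
    rw [map_zero]
    refine inj_fiber x _ ?_
    rw [← evalSections_act hS.form01.1, ← hs, ← map_add, hv, map_zero]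
  have surj : ∀ w, ∃ v, w = v + s v := by
    intro w
    -- The fibrewise inverse of `I + S` is not known to preserve smoothness, but this formula does.
    -- If `w = u + Su`, then `JKw = -u + Su`, so `w - JKw = 2u`.
    refine ⟨(1 / 2 : ℝ) • (w - j (K w)), sections_ext fun x => ?_⟩
    obtain ⟨u, hu⟩ : ∃ u, evalSections x w = u + S x u := by
      refine ⟨Ring.inverse (1 + S x) (evalSections x w), ?_⟩
      exact (congrArg (fun l => l (evalSections x w))
        (Ring.mul_inverse_cancel _ (hS.isUnit x))).symm
    have e : evalSections x ((1 / 2 : ℝ) • (w - j (K w))) = u := by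
      rw [map_smul, map_sub, hj, evalSections_act, eval_K w x u hu, hu, map_add, hJ.2,
        hS.form01.2, map_neg, hJ.2]
      module
    rw [map_add, hs, evalSections_act, e, hu]
  have add_left : ∀ U V W, lieDefSections hγ hα h (U + V) W =
      lieDefSections hγ hα h U W + lieDefSections hγ hα h V W := fun U V W => by
    rw [lieDefSections, lieDefSections, lieDefSections, ← map_add, map_add]
    congr 1
    exact Subtype.ext (lie_add_left (omegaSections hγ hα U).2.1 (omegaSections hγ hα V).2.1)
  have anti : ∀ V W, lieDefSections hγ hα h V W = -lieDefSections hγ hα h W V := fun V W => by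
    rw [lieDefSections, lieDefSections, ← map_neg]
    congr 1
    exact Subtype.ext VectorField.mlieBracket_swap
  have main := nijenhuis_eq_zero_iff (lieDefSections hγ hα h) add_left anti j s K hjj hsj inj surj
    hK
  have transfer : ∀ V W, nijenhuis (lieSections h) jα (Ω V) (Ω W) =
      Ω (nijenhuis (lieDefSections hγ hα h) K V W) := fun V W => by
    simp [nijenhuis, lieDefSections, hKdef, ← hΩ]
  constructor
  · intro H V W hV hW
    -- The operations on `sections ξ` have `lieDef X α`, `act ξ J` and `act ξ S` as underlying
    -- operations by definition; all brackets stay tangent, so the default value of `act` never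
    -- occurs.
    refine congrArg Subtype.val (main.1 (fun V W => ?_) ⟨V, hV⟩ ⟨W, hW⟩)
    rw [← Ω.map_eq_zero_iff, ← transfer]
    exact Subtype.ext (H _ _ (Ω V).2 (Ω W).2)
  · intro H V W hV hW
    have := main.2 (fun V W => Subtype.ext (H V.1 W.1 V.2 W.2)) (Ω.symm ⟨V, hV⟩) (Ω.symm ⟨W, hW⟩)
    rw [← Ω.map_eq_zero_iff, ← transfer, Ω.apply_symm_apply, Ω.apply_symm_apply] at this
    exact congrArg Subtype.val this

/-! ### The deformed bracket and the form `α^{0,1} ∧ H` -/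

/-- For integrable `ξ` and `ξ_α`, the deformed bracket is
`[V,W]_α = [V,W] - α(W) T(V) + α(V) T(W)`. -/
theorem lieDef_eq [CompleteSpace E] (hξ : IsIntegrable ξ) (hγ : IsDefiningCouple ξ γ X)
    (hα : IsZOne X α) (h : IsIntegrable (xiDef γ α)) {V W : ∀ x : M, TangentSpace 𝓘(ℝ, E) x}
    (hV : IsSection ξ V) (hW : IsSection ξ W) (x : M) :
    lieDef X α V W x =
      lie V W x - α x (W x) • torsionT γ X V x + α x (V x) • torsionT γ X W x := by
  have hVW : γ x (lie V W x) = 0 := (hγ.ker_eq x).le (hξ V W hV hW x)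
  set L := lie (V - evalForm α V • X) (W - evalForm α W • X) x with hL
  have h0 : γ x L + α x L = 0 :=
    h _ _ (omegaSections hγ hα ⟨V, hV⟩).2 (omegaSections hγ hα ⟨W, hW⟩).2 x
  -- As `L` is tangent to `ξ_α`, `α(L) = -γ(L)`: here `ω_α⁻¹` is the projection to `ξ` along `X`,
  -- which discards the `X`-terms of the Leibniz rule.
  have e : lieDef X α V W x = L - γ x L • X x := by
    change L + α x L • X x = _
    rw [eq_neg_of_add_eq_zero_right h0]
    module
  rw [e, hL, lie_sub_smul hV.1 hW.1 hγ.smooth_field (hα.smooth.eval hV.1) (hα.smooth.eval hW.1)]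
  simp only [torsionT, map_sub, map_add, map_smul, hVW, hγ.apply_eq_one, evalForm, smul_eq_mul]
  module

/-- The Nijenhuis tensor of `J` with respect to the deformed bracket. -/
theorem nijenhuis_lieDef [CompleteSpace E] (hξJ : IsLeviFlat ξ J) (hγ : IsDefiningCouple ξ γ X)
    (hα : IsZOne X α) (h : IsIntegrable (xiDef γ α)) {V W : ∀ x : M, TangentSpace 𝓘(ℝ, E) x}
    (hV : IsSection ξ V) (hW : IsSection ξ W) :
    (1 / 4 : ℝ) • nijenhuis (lieDef X α) (act ξ J) V W = -wedgeH ξ J γ X α V W := by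
  have hξ := hξJ.integrable
  have hJV := hξJ.complexStructure.1 V hV
  have hJW := hξJ.complexStructure.1 W hW
  funext x
  have torsion_mem : ∀ U, torsionT γ X U x ∈ ξ x := fun U => by
    rw [hγ.ker_eq]
    change γ x (lie U X x - γ x (lie U X x) • X x) = 0
    simp [hγ.apply_eq_one]
  -- Writing the values as elements of the fibre `ξ x` lets `J x` act linearly on each summand.
  have bracket : ∀ {V W : ∀ x : M, TangentSpace 𝓘(ℝ, E) x} (hV : IsSection ξ V)
      (hW : IsSection ξ W), lieDef X α V W x =
        ((⟨lie V W x, hξ V W hV hW x⟩ - α x (W x) • ⟨torsionT γ X V x, torsion_mem V⟩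
          + α x (V x) • ⟨torsionT γ X W x, torsion_mem W⟩ : ξ x) : TangentSpace 𝓘(ℝ, E) x) :=
    fun hV hW => lieDef_eq hξ hγ hα h hV hW x
  have formH_eq : ∀ U, formH ξ J γ X U x =
      (((1 / 2 : ℝ) • (⟨torsionT γ X U x, torsion_mem U⟩
        + J x ⟨torsionT γ X (act ξ J U) x, torsion_mem _⟩) : ξ x) :
          TangentSpace 𝓘(ℝ, E) x) := fun U => by
    change (1 / 2 : ℝ) • (torsionT γ X U x + act ξ J (torsionT γ X (act ξ J U)) x) = _
    rw [act_apply (v := ⟨torsionT γ X (act ξ J U) x, torsion_mem _⟩) rfl]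
    rfl
  have hN := congrFun (hξJ.nijenhuis_eq_zero V W hV hW) x
  simp only [nijenhuis, Pi.sub_apply, Pi.zero_apply] at hN
  rw [act_apply (v := ⟨_, hξ _ _ hJV hW x⟩) rfl, act_apply (v := ⟨_, hξ _ _ hV hJW x⟩) rfl] at hN
  simp only [nijenhuis, wedgeH, cmul, Pi.smul_apply, Pi.sub_apply, Pi.neg_apply]
  rw [act_apply (bracket hJV hW), act_apply (bracket hV hJW), act_apply (formH_eq V),
    act_apply (formH_eq W), bracket hJV hJW, bracket hV hW, formH_eq, formH_eq]
  have re_part : ∀ U, (part01 ξ J α U x).re = 1 / 2 * α x (U x) := fun U => by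
    simp [part01, evalForm]
  have im_part : ∀ U, (part01 ξ J α U x).im = 1 / 2 * α x (act ξ J U x) := fun U => by
    simp [part01, evalForm]
  simp only [re_part, im_part, map_add, map_sub, map_smul, Submodule.coe_add, Submodule.coe_sub,
    Submodule.coe_smul, hξJ.complexStructure.2, Submodule.coe_neg]
  -- The undeformed brackets add up to `¼` of the leafwise Nijenhuis tensor, which is zero; the
  -- `T`-terms match those of `-α^{0,1} ∧ H`.
  linear_combination (norm := module) (1 / 4 : ℝ) • hN

end Sections
end LeviFlat

end

/-! ### The equivalence -/

open LeviFlat in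
theorem mainTheorem4 {E : Type*} [NormedAddCommGroup E] [NormedSpace ℝ E]
    [FiniteDimensional ℝ E] {L : Type*} [TopologicalSpace L] [T2Space L]
    [ChartedSpace E L] [IsManifold 𝓘(ℝ, E) ∞ L]
    (ξ : ∀ x : L, Submodule ℝ (TangentSpace 𝓘(ℝ, E) x))
    (J : ∀ x : L, Module.End ℝ (ξ x)) (hξJ : IsLeviFlat ξ J)
    (γ : ∀ x : L, TangentSpace 𝓘(ℝ, E) x →L[ℝ] ℝ)
    (X : ∀ x : L, TangentSpace 𝓘(ℝ, E) x) (hγ : IsDefiningCouple ξ γ X)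
    (α : ∀ x : L, TangentSpace 𝓘(ℝ, E) x →L[ℝ] ℝ) (hα : IsZOne X α)
    (Jα : ∀ x : L, Module.End ℝ (xiDef γ α x))
    (hJα : IsComplexStructure (xiDef γ α) Jα)
    (S : ∀ x : L, Module.End ℝ (ξ x)) (hS : Encodes hγ hα J Jα S) :
    IsLeviFlat (xiDef γ α) Jα ↔
      MaurerCartan γ X α ∧
      ∀ V W : ∀ x : L, TangentSpace 𝓘(ℝ, E) x, IsSection ξ V → IsSection ξ W →
        dbarOne (lieDef X α) (act ξ J) (act ξ S) V W
            + (1 / 2 : ℝ) • doubleBracket (lieDef X α) (act ξ J) (act ξ S) V W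
          = (1 / 4 : ℝ) • nijenhuis (lieDef X α) (act ξ J) V W ∧
        (1 / 4 : ℝ) • nijenhuis (lieDef X α) (act ξ J) V W = -wedgeH ξ J γ X α V W := by
  have : CompleteSpace E := FiniteDimensional.complete ℝ E
  rw [maurerCartan_iff hξJ.integrable hγ hα]
  constructor
  · intro h
    exact ⟨h.integrable, fun V W hV hW =>
      ⟨(nijenhuis_xiDef_iff hξJ.complexStructure hγ hα hJα.1 hS h.integrable).1
        h.nijenhuis_eq_zero V W hV hW, nijenhuis_lieDef hξJ hγ hα h.integrable hV hW⟩⟩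
  · rintro ⟨h, H⟩
    -- Only the first equality is used here; the second follows from integrability of `ξ_α`.
    exact ⟨isCodimOne_xiDef hγ hα, h, hJα,
      (nijenhuis_xiDef_iff hξJ.complexStructure hγ hα hJα.1 hS h).2
        fun V W hV hW => (H V W hV hW).1⟩
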